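/- Let $\nu\in(0,1]$, $L>0$ and $\bar\varepsilon>0$. Then there are constants $c_1,c_2>0$ and a smoothing parameter $\mu=\mu(n,\varepsilon)\in(0,1)$, defined for integers $n\ge 1$ and $0<\varepsilon\le\bar\varepsilon$ and depending only on $n,\varepsilon,\nu,L,\bar\varepsilon$, such that $$c_1\,\frac{\varepsilon^{\frac{3+\nu}{4\nu}}}{n^{\frac{3+7\nu}{4\nu}}}\;\le\;\frac{\mu^{\frac{3+\nu}{2}}}{n^{\frac{3-\nu}{4}}}\;\le\; c_2\,\frac{\varepsilon^{\frac{3+\nu}{4\nu}}}{n^{\frac{3+7\nu}{4\nu}}},$$ and for every $\Delta\in\mathbb{R}$ there is a constant $C>0$ (depending only on $\nu,L,\bar\varepsilon,\Delta$ and the choice of $\mu(\cdot,\cdot)$) such that for all $n\ge1$ and $0<\varepsilon\le\bar\varepsilon$ there is a number of steps $$N\;\le\; C\,\frac{n^{2+\frac{1-\nu}{2\nu}}}{\varepsilon^{\frac1\nu}}$$ for which the following holds. Let $E$ be an $n$-dimensional real vector space with dual $E^*$, with the Euclidean norms $\|x\|^2=\langle Bx,x\rangle$ on $E$ and $\|s\|_*^2=\langle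 s,B^{-1}s\rangle$ on $E^*$, where $B:E\to E^*$ is linear, self-adjoint and positive definite. Let $f:E\to\mathbb{R}$ be differentiable and bounded below with $\|\nabla f(y)-\nabla f(x)\|_*\le L\|y-x\|^\nu$ for all $x,y\in E$. Let $x_0\in E$ satisfy $f(x_0)-\inf f\le\Delta$, and let $\tilde f:E\to\mathbb{R}$ be a measurable inexact zeroth-order oracle, $|f(x)-\tilde f(x)|\le\delta$ for all $x\in E$, with noise level $$\delta<\frac{\mu^{\frac{3+\nu}{2}}}{n^{\frac{3-\nu}{4}}}.$$ Let $u_0,u_1,\dots$ be independent standard Gaussian vectors in $E$ (density proportional to $e^{-\|u\|^2/2}$), and let $$x_{k+1}=x_k-h\,B^{-1}g_\mu(x_k,u_k),\qquad g_\mu(x,u)=\frac{\tilde f(x+\mu u)-\tilde f(x)}{\mu}\,Bu,\qquad h=\frac{\mu^{1-\nu}}{80\,(n+4)\,L\,n^{\frac{1+\nu}{2}}}.$$ Then $\mathbb{E}\|\nabla f(x_k)\|_*^2<\infty$ for all $0\le k<N$, and $$\min_{0\le k\le N-1}\mathbb{E}\,\|\nabla f(x_k)\|_*^2\le\varepsilon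 .$$ -/

import Mathlib

open MeasureTheory ProbabilityTheory

noncomputable section

namespace ZerothOrder

/-! The space `E` with `‖x‖² = ⟨B x, x⟩` for a positive definite self-adjoint `B : E → E*` is a
finite-dimensional real inner product space.  Its dual is `StrongDual ℝ E`, whose operator norm is
the norm `‖s‖_*² = ⟨s, B⁻¹ s⟩`, and `B` is the Riesz isomorphism `InnerProductSpace.toDual ℝ E`.
The gradient of `f` at `x`, as an element of the dual, is `fderiv ℝ f x`.  The Gaussian vector with
density proportional to `exp (-‖u‖² / 2)` has law `stdGaussian E`. -/

variable {E : Type*} [NormedAddCommGroup E] [InnerProductSpace ℝ E]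

/-- `f` is differentiable and its gradient is Hölder-continuous with exponent `ν` and
constant `L`. -/
def HasHolderGradient (f : E → ℝ) (ν L : ℝ) : Prop :=
  Differentiable ℝ f ∧ ∀ x y : E, ‖fderiv ℝ f y - fderiv ℝ f x‖ ≤ L * ‖y - x‖ ^ ν

/-- `ftil` is a zeroth-order oracle for `f` with error at most `δ`. -/
def IsInexactOracle (f ftil : E → ℝ) (δ : ℝ) : Prop :=
  ∀ x : E, |f x - ftil x| ≤ δ

variable [FiniteDimensional ℝ E]

/-- The finite-difference estimator `g_μ(x, u) = (ftil (x + μ u) - ftil x) / μ • B u`. -/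
def gradEstimator (ftil : E → ℝ) (μ : ℝ) (x u : E) : StrongDual ℝ E :=
  ((ftil (x + μ • u) - ftil x) / μ) • InnerProductSpace.toDual ℝ E u

/-- The process `x_{k+1} = x_k - h B⁻¹ g_μ(x_k, u_k)` started at `x₀`, with step size `h`, along
the sequence of directions `u`. -/
def gdProcess (ftil : E → ℝ) (μ h : ℝ) (x₀ : E) (u : ℕ → E) : ℕ → E
  | 0 => x₀
  | k + 1 =>
    gdProcess ftil μ h x₀ u k -
      h • (InnerProductSpace.toDual ℝ E).symm
        (gradEstimator ftil μ (gdProcess ftil μ h x₀ u k) (u k))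

/-- The step size `h = 1 / (80 (n + 4) A)` with `A = L n ^ ((1 + ν) / 2) / μ ^ (1 - ν)`. -/
def stepSize (ν L μ : ℝ) (n : ℕ) : ℝ :=
  1 / (80 * ((n : ℝ) + 4) * (L * (n : ℝ) ^ ((1 + ν) / 2) / μ ^ (1 - ν)))

/-- The noise level `μ ^ ((3 + ν) / 2) / n ^ ((3 - ν) / 4)`. -/
def noiseLevel (ν μ : ℝ) (n : ℕ) : ℝ :=
  μ ^ ((3 + ν) / 2) / (n : ℝ) ^ ((3 - ν) / 4)

/-- The order `ε ^ ((3 + ν) / (4 ν)) / n ^ ((3 + 7 ν) / (4 ν))` of the noise level. -/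
def noiseOrder (ν ε : ℝ) (n : ℕ) : ℝ :=
  ε ^ ((3 + ν) / (4 * ν)) / (n : ℝ) ^ ((3 + 7 * ν) / (4 * ν))

/-- The order `n ^ (2 + (1 - ν) / (2 ν)) / ε ^ (1 / ν)` of the number of steps. -/
def stepsOrder (ν ε : ℝ) (n : ℕ) : ℝ :=
  (n : ℝ) ^ (2 + (1 - ν) / (2 * ν)) / ε ^ (1 / ν)

end ZerothOrder

end

/-! Along a direction `u` the difference quotient is `φ u` plus an error, with `φ = fderiv ℝ f x`.
The Hölder bound and the oracle noise bound the squared error by `D (1 + ‖u‖⁴/n²)`, where `D = 2M +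
8(δ/μ)²` and `M = L² μ^(2ν) n^(1+ν)` (`smoothingError`). The remainder `L ‖step‖^(1+ν)` is not
quadratic; Young's inequality at scale `μ/√n` replaces it by a quadratic term, small for the given
step size `h`, plus a constant `O(hM)`. So `apply_gdStep_le_stepBound` involves only Gaussian
moments of integer order, and averaging gives `E f(x⁺) ≤ f x - (h/2)‖φ‖² + h(410 M + 40(δ/μ)²)`.
Since `x_k` is independent of `u_k`, this holds along the process and telescopes
(`integrable_and_sum_integral_le`). With `μ^(2ν) = κε/n^(1+ν)` and `κ` small, the error is at most
`ε/4`; once `N h ε ≥ 4 (f x₀ - inf f)`, the average of the expected squared gradients is at most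
`ε`. -/

/-! ### Gaussian moments -/

/-- The even moments of the standard real Gaussian distribution. -/
lemma integral_pow_two_mul_gaussianReal (k : ℕ) :
    ∫ x, x ^ (2 * k) ∂(gaussianReal 0 1) = ((2 * k - 1 : ℕ).doubleFactorial : ℝ) := by
  rw [integral_gaussianReal_eq_integral_smul one_ne_zero]
  let F : ℝ → ℝ := fun y =>
    (√(2 * Real.pi))⁻¹ * (y ^ ((2 * k : ℕ) : ℝ) * Real.exp (-(1 / 2) * y ^ (2 : ℝ)))
  have h1 : ∀ x : ℝ, gaussianPDFReal 0 1 x • x ^ (2 * k) = F |x| := by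
    intro x
    simp only [F, gaussianPDFReal, smul_eq_mul, Real.rpow_natCast, Real.rpow_two, sq_abs,
      NNReal.coe_one, mul_one, sub_zero]
    rw [(even_two_mul k).pow_abs]
    ring_nf
  rw [integral_congr_ae (ae_of_all _ h1), integral_comp_abs (f := F), integral_const_mul,
    integral_rpow_mul_exp_neg_mul_rpow two_pos (by linarith [(2 * k : ℕ).cast_nonneg (α := ℝ)])
      (by norm_num)]
  have h2 : (((2 * k : ℕ) : ℝ) + 1) / 2 = k + 1 / 2 := by push_cast; ring
  rw [h2, Real.Gamma_nat_add_half, neg_div, h2, one_div (2 : ℝ), Real.inv_rpow zero_le_two,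
    Real.rpow_neg zero_le_two, inv_inv, Real.rpow_add two_pos, Real.rpow_natCast,
    ← one_div (2 : ℝ), ← Real.sqrt_eq_rpow, Real.sqrt_mul zero_le_two]
  have : √Real.pi ≠ 0 := (Real.sqrt_pos.2 Real.pi_pos).ne'
  have : √(2 : ℝ) ≠ 0 := by positivity
  field_simp

section StdGaussian

variable {E : Type*} [NormedAddCommGroup E] [InnerProductSpace ℝ E]
    [FiniteDimensional ℝ E] [MeasurableSpace E] [BorelSpace E]

lemma integrable_norm_pow_stdGaussian (k : ℕ) :
    Integrable (fun u : E => ‖u‖ ^ k) (stdGaussian E) :=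
  (IsGaussian.memLp_id (stdGaussian E) k (by simp)).integrable_norm_pow'

lemma integrable_dual_pow_mul_norm_pow_stdGaussian (φ : StrongDual ℝ E) (j k : ℕ) :
    Integrable (fun u : E => φ u ^ j * ‖u‖ ^ k) (stdGaussian E) := by
  refine ((integrable_norm_pow_stdGaussian (j + k)).const_mul (‖φ‖ ^ j)).mono'
    (by fun_prop) (ae_of_all _ fun u => ?_)
  rw [norm_mul, norm_pow, norm_pow, norm_norm, pow_add, ← mul_assoc, ← mul_pow]
  gcongr
  exact φ.le_opNorm u

lemma integrable_dual_pow_stdGaussian (φ : StrongDual ℝ E) (k : ℕ) :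
    Integrable (fun u : E => φ u ^ k) (stdGaussian E) := by
  simpa using integrable_dual_pow_mul_norm_pow_stdGaussian φ k 0

/-- The even moments of a linear functional under the standard Gaussian distribution. -/
lemma integral_dual_pow_two_mul_stdGaussian (φ : StrongDual ℝ E) (k : ℕ) :
    ∫ u, φ u ^ (2 * k) ∂(stdGaussian E) =
      ‖φ‖ ^ (2 * k) * ((2 * k - 1 : ℕ).doubleFactorial : ℝ) := by
  -- Both sides are the centred Gaussian law of variance `‖φ‖²`.
  have h1 : (stdGaussian E).map φ = (gaussianReal 0 1).map (‖φ‖ * ·) := by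
    rw [IsGaussian.map_eq_gaussianReal, integral_strongDual_stdGaussian,
      variance_dual_stdGaussian, gaussianReal_map_const_mul]
    congr 1
    · simp
    · ext
      simp
  have h2 : ∫ u, φ u ^ (2 * k) ∂(stdGaussian E) =
      ∫ x, x ^ (2 * k) ∂((stdGaussian E).map φ) := by
    rw [integral_map (by fun_prop) (by fun_prop)]
  rw [h2, h1, integral_map (by fun_prop) (by fun_prop)]
  simp_rw [mul_pow]
  rw [integral_const_mul, integral_pow_two_mul_gaussianReal]

lemma integral_dual_sq_stdGaussian (φ : StrongDual ℝ E) :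
    ∫ u, φ u ^ 2 ∂(stdGaussian E) = ‖φ‖ ^ 2 := by
  simpa [Nat.doubleFactorial] using integral_dual_pow_two_mul_stdGaussian φ 1

lemma integral_dual_pow_four_stdGaussian (φ : StrongDual ℝ E) :
    ∫ u, φ u ^ 4 ∂(stdGaussian E) = 3 * ‖φ‖ ^ 4 := by
  simpa [Nat.doubleFactorial, mul_comm] using integral_dual_pow_two_mul_stdGaussian φ 2

lemma norm_sq_eq_sum_sq_inner {E ι : Type*} [NormedAddCommGroup E] [InnerProductSpace ℝ E]
    [Fintype ι] (b : OrthonormalBasis ι ℝ E) (u : E) :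
    ‖u‖ ^ 2 = ∑ i, innerSL ℝ (b i) u ^ 2 := by
  rw [← b.sum_sq_norm_inner_right u]
  simp

/-- The even moments of the norm under the standard Gaussian distribution are at most those of
`√n` times a standard real Gaussian variable, where `n` is the dimension. -/
lemma integral_norm_pow_stdGaussian_le (k : ℕ) :
    ∫ u : E, ‖u‖ ^ (2 * (k + 1)) ∂(stdGaussian E) ≤
      ((2 * (k + 1) - 1 : ℕ).doubleFactorial : ℝ) * (Module.finrank ℝ E : ℝ) ^ (k + 1) := by
  let b := stdOrthonormalBasis ℝ E
  calc ∫ u : E, ‖u‖ ^ (2 * (k + 1)) ∂(stdGaussian E)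
      ≤ ∫ u : E, (Module.finrank ℝ E : ℝ) ^ k *
          ∑ i, innerSL ℝ (b i) u ^ (2 * (k + 1)) ∂(stdGaussian E) := by
        refine integral_mono (integrable_norm_pow_stdGaussian _) (Integrable.const_mul
          (integrable_finsetSum _ fun i _ => integrable_dual_pow_stdGaussian _ _) _) fun u => ?_
        -- Power mean inequality for the squared coordinates; it leaves only moments of single
        -- coordinates.
        have h := pow_sum_le_card_mul_sum_pow (s := Finset.univ)
          (f := fun i => innerSL ℝ (b i) u ^ 2) (fun i _ => sq_nonneg _) k
        simpa only [pow_mul, norm_sq_eq_sum_sq_inner b u, Finset.card_univ, Fintype.card_fin]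
          using h
    _ = _ := by
        rw [integral_const_mul,
          integral_finsetSum _ fun i _ => integrable_dual_pow_stdGaussian _ _]
        simp_rw [integral_dual_pow_two_mul_stdGaussian, innerSL_apply_norm, b.norm_eq_one]
        simp
        ring

/-- AM-GM against each coordinate, rescaled to have the same norm as `φ`, reduces the mixed moment
to fourth moments. The exact factor is `n + 2`; `3n` suffices. -/
lemma integral_dual_sq_mul_norm_sq_stdGaussian_le (φ : StrongDual ℝ E) :
    ∫ u : E, φ u ^ 2 * ‖u‖ ^ 2 ∂(stdGaussian E) ≤ 3 * Module.finrank ℝ E * ‖φ‖ ^ 2 := by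
  let b := stdOrthonormalBasis ℝ E
  let ψ := fun i => ‖φ‖ • innerSL ℝ (b i)
  rcases eq_or_ne φ 0 with rfl | hφ
  · simp
  have hφ : 0 < ‖φ‖ := norm_pos_iff.2 hφ
  have hint : ∀ i, Integrable (fun u => (φ u ^ 4 + ψ i u ^ 4) / (2 * ‖φ‖ ^ 2)) (stdGaussian E) :=
    fun i => ((integrable_dual_pow_stdGaussian φ 4).add
      (integrable_dual_pow_stdGaussian (ψ i) 4)).div_const _
  calc ∫ u : E, φ u ^ 2 * ‖u‖ ^ 2 ∂(stdGaussian E)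
      ≤ ∫ u : E, ∑ i, (φ u ^ 4 + ψ i u ^ 4) / (2 * ‖φ‖ ^ 2) ∂(stdGaussian E) := by
        refine integral_mono (integrable_dual_pow_mul_norm_pow_stdGaussian _ _ _)
          (integrable_finsetSum _ fun i _ => hint i) fun u => ?_
        simp only [norm_sq_eq_sum_sq_inner b u, Finset.mul_sum]
        refine Finset.sum_le_sum fun i _ => ?_
        rw [le_div_iff₀ (by positivity)]
        simp only [ψ, smul_apply, smul_eq_mul]
        nlinarith [sq_nonneg (φ u ^ 2 - (‖φ‖ * innerSL ℝ (b i) u) ^ 2)]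
    _ = _ := by
        rw [integral_finsetSum _ fun i _ => hint i]
        have h : ∀ i, ∫ u, (φ u ^ 4 + ψ i u ^ 4) / (2 * ‖φ‖ ^ 2) ∂(stdGaussian E)
            = 3 * ‖φ‖ ^ 2 := by
          intro i
          rw [integral_div, integral_add (integrable_dual_pow_stdGaussian φ 4)
            (integrable_dual_pow_stdGaussian (ψ i) 4), integral_dual_pow_four_stdGaussian,
            integral_dual_pow_four_stdGaussian, norm_smul, innerSL_apply_norm, b.norm_eq_one]
          simp
          field_simp
          norm_num
        simp [h]
        ring

end StdGaussian

/-! ### Young's inequality and Hölder gradients -/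

lemma Real.rpow_one_add_le_one_add_sq {t ν : ℝ} (ht : 0 ≤ t) (hν₀ : 0 ≤ ν) (hν₁ : ν ≤ 1) :
    t ^ (1 + ν) ≤ 1 + t ^ 2 := by
  rcases le_total t 1 with h | h
  · have := Real.rpow_le_one ht h (by linarith : 0 ≤ 1 + ν)
    nlinarith [sq_nonneg t]
  · have := Real.rpow_le_rpow_of_exponent_le h
      (by push_cast; linarith : 1 + ν ≤ (2 : ℕ))
    rw [Real.rpow_natCast] at this
    linarith

/-- Young's inequality with a scale `s`. -/
lemma Real.rpow_one_add_le_scaled {t s ν : ℝ} (ht : 0 ≤ t) (hs : 0 < s) (hν₀ : 0 ≤ ν)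
    (hν₁ : ν ≤ 1) : t ^ (1 + ν) ≤ s ^ (1 + ν) + s ^ (1 + ν) / s ^ 2 * t ^ 2 := by
  have h := Real.rpow_one_add_le_one_add_sq (div_nonneg ht hs.le) hν₀ hν₁
  rw [Real.div_rpow ht hs.le, div_le_iff₀ (by positivity)] at h
  calc _ ≤ _ := h
    _ = _ := by rw [div_pow]; ring

namespace ZerothOrder

section Holder

variable {E : Type*} [NormedAddCommGroup E] [InnerProductSpace ℝ E]

/-- Mean value inequality on the segment, where the gradient varies by at most `L‖y - x‖^ν`; hence
the constant `L` rather than `L/(1+ν)`. -/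
lemma HasHolderGradient.abs_sub_le {f : E → ℝ} {ν L : ℝ} (hf : HasHolderGradient f ν L)
    (hν : 0 < ν) (hL : 0 ≤ L) (x y : E) :
    |f y - f x - fderiv ℝ f x (y - x)| ≤ L * ‖y - x‖ ^ (1 + ν) := by
  rcases eq_or_ne y x with rfl | hxy
  · simp [Real.zero_rpow (by linarith : 1 + ν ≠ 0)]
  have hpos : 0 < ‖y - x‖ := norm_pos_iff.2 (sub_ne_zero.2 hxy)
  have h := (convex_segment (𝕜 := ℝ) x y).norm_image_sub_le_of_norm_fderiv_le'
    (f := f) (φ := fderiv ℝ f x) (C := L * ‖y - x‖ ^ ν) (𝕜 := ℝ)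
    (fun z _ => hf.1 z) (fun z hz => (hf.2 x z).trans ?_)
    (left_mem_segment ℝ x y) (right_mem_segment ℝ x y)
  · rwa [mul_assoc, ← Real.rpow_add_one hpos.ne', add_comm ν] at h
  · gcongr
    exact norm_sub_le_of_mem_segment hz

end Holder

/-- The contribution `L² μ ^ (2 ν) n ^ (1 + ν)` of the smoothing to the error in one step. -/
noncomputable def smoothingError (ν L μ : ℝ) (n : ℕ) : ℝ :=
  L ^ 2 * μ ^ (2 * ν) * (n : ℝ) ^ (1 + ν)

lemma smoothingError_nonneg {ν L μ : ℝ} {n : ℕ} (hμ : 0 < μ) : 0 ≤ smoothingError ν L μ n := by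
  unfold smoothingError
  positivity

section Scalar

variable {ν L μ : ℝ} {n : ℕ}

lemma stepSize_pos (hL : 0 < L) (hμ : 0 < μ) (hn : 1 ≤ n) : 0 < stepSize ν L μ n := by
  have : (0 : ℝ) < n := by exact_mod_cast hn
  unfold stepSize
  positivity

/-- Turns the Hölder remainder of a step of length `h a` into a quadratic term that the descent can
absorb and a constant of the order of the smoothing error. -/
lemma holder_term_le_of_stepSize (hν₀ : 0 < ν) (hν₁ : ν ≤ 1) (hL : 0 < L) (hμ : 0 < μ)
    (hn : 1 ≤ n) {a : ℝ} (ha : 0 ≤ a) :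
    L * (stepSize ν L μ n * a) ^ (1 + ν) ≤
      stepSize ν L μ n / (80 * n) * a ^ 2 + 400 * stepSize ν L μ n * smoothingError ν L μ n := by
  have hn1 : (1 : ℝ) ≤ n := by exact_mod_cast hn
  have hn0 : (0 : ℝ) < n := by linarith
  set h := stepSize ν L μ n with hh
  have hpos : 0 < h := stepSize_pos hL hμ hn
  set A := L * (n : ℝ) ^ ((1 + ν) / 2) / μ ^ (1 - ν) with hA
  have hA0 : 0 < A := by positivity
  have hhA : h * A = 1 / (80 * (n + 4)) := by
    rw [hh, stepSize, ← hA]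
    field_simp
  set s := μ / √n with hs
  have hs0 : 0 < s := by positivity
  have hspow : s ^ (1 + ν) = μ ^ (1 + ν) / (n : ℝ) ^ ((1 + ν) / 2) := by
    rw [hs, Real.div_rpow hμ.le (by positivity), Real.sqrt_eq_rpow, ← Real.rpow_mul hn0.le]
    ring_nf
  have hμ1 : μ ^ (1 + ν) = μ ^ (2 * ν) * μ ^ (1 - ν) := by
    rw [← Real.rpow_add hμ]
    ring_nf
  have hμ2 : μ ^ (1 + ν) * μ ^ (1 - ν) = μ ^ 2 := by
    rw [← Real.rpow_add hμ, ← Real.rpow_natCast]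
    norm_num
  have hn2 : (n : ℝ) ≤ (n : ℝ) ^ (1 + ν) := by
    simpa using Real.rpow_le_rpow_of_exponent_le hn1 (by linarith : 1 ≤ 1 + ν)
  have hn3 : (n : ℝ) ^ ((1 + ν) / 2) * (n : ℝ) ^ ((1 + ν) / 2) = (n : ℝ) ^ (1 + ν) := by
    rw [← Real.rpow_add hn0]
    ring_nf
  have h1 : L * s ^ (1 + ν) ≤ 400 * h * smoothingError ν L μ n := by
    have e : L * s ^ (1 + ν) = h * (80 * (n + 4)) * (L ^ 2 * μ ^ (2 * ν)) := by
      calc L * s ^ (1 + ν) = (h * A * (80 * (n + 4))) * (L * s ^ (1 + ν)) := by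
            rw [hhA]
            field_simp
        _ = _ := by
            rw [hspow, hA, hμ1]
            field_simp
    rw [e, smoothingError]
    have : (n : ℝ) + 4 ≤ 5 * (n : ℝ) ^ (1 + ν) := by linarith
    calc h * (80 * (n + 4)) * (L ^ 2 * μ ^ (2 * ν))
        ≤ h * (80 * (5 * (n : ℝ) ^ (1 + ν))) * (L ^ 2 * μ ^ (2 * ν)) := by gcongr
      _ = _ := by ring
  have h2 : L * (s ^ (1 + ν) / s ^ 2) ≤ A := by
    have e : s ^ 2 = μ ^ 2 / n := by rw [hs, div_pow, Real.sq_sqrt hn0.le]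
    rw [hspow, e, hA, ← hμ2]
    have : L * (μ ^ (1 + ν) / (n : ℝ) ^ ((1 + ν) / 2) / (μ ^ (1 + ν) * μ ^ (1 - ν) / n)) =
        L * (n / (n : ℝ) ^ ((1 + ν) / 2)) / μ ^ (1 - ν) := by
      field_simp
    rw [this]
    gcongr
    rw [div_le_iff₀ (by positivity), hn3]
    exact hn2
  have h3 := Real.rpow_one_add_le_scaled (mul_nonneg hpos.le ha) hs0 hν₀.le hν₁
  calc L * (h * a) ^ (1 + ν)
      ≤ L * (s ^ (1 + ν) + s ^ (1 + ν) / s ^ 2 * (h * a) ^ 2) := by gcongr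
    _ = L * s ^ (1 + ν) + L * (s ^ (1 + ν) / s ^ 2) * (h * a) ^ 2 := by ring
    _ ≤ 400 * h * smoothingError ν L μ n + A * (h * a) ^ 2 := by gcongr
    _ = h * (h * A) * a ^ 2 + 400 * h * smoothingError ν L μ n := by ring
    _ ≤ _ := by
      gcongr
      rw [hhA, div_eq_mul_one_div h]
      gcongr
      linarith

end Scalar

/-! ### Expected decrease in one step -/

section OneStep

variable {E : Type*} [NormedAddCommGroup E] [InnerProductSpace ℝ E]
  {f ftil : E → ℝ} {ν L μ δ : ℝ} {n : ℕ}

/-- The difference quotient of an inexact oracle along `u` approximates the derivative. -/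
lemma sq_differenceQuotient_sub_fderiv_le (hf : HasHolderGradient f ν L)
    (ho : IsInexactOracle f ftil δ) (hν₀ : 0 < ν) (hν₁ : ν ≤ 1) (hL : 0 < L) (hμ : 0 < μ)
    (hn : 1 ≤ n) (x u : E) :
    ((ftil (x + μ • u) - ftil x) / μ - fderiv ℝ f x u) ^ 2 ≤
      (2 * smoothingError ν L μ n + 8 * (δ / μ) ^ 2) * (1 + ‖u‖ ^ 4 / n ^ 2) := by
  have hn0 : (0 : ℝ) < n := by exact_mod_cast hn
  set q := (ftil (x + μ • u) - ftil x) / μ - fderiv ℝ f x u with hq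
  have h1 := hf.abs_sub_le hν₀ hL.le x (x + μ • u)
  rw [add_sub_cancel_left, map_smul, smul_eq_mul, norm_smul, Real.norm_of_nonneg hμ.le,
    Real.mul_rpow hμ.le (norm_nonneg u), Real.rpow_add hμ, Real.rpow_one] at h1
  have h2 := ho x
  have h3 := ho (x + μ • u)
  have hδ : 0 ≤ δ := (abs_nonneg _).trans h2
  -- Taylor remainder plus two oracle errors.
  have hμq : |μ * q| ≤ μ * (L * μ ^ ν * ‖u‖ ^ (1 + ν) + 2 * (δ / μ)) := by
    have e : μ * q = (f (x + μ • u) - f x - μ * fderiv ℝ f x u)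
        - (f (x + μ • u) - ftil (x + μ • u)) + (f x - ftil x) := by
      rw [hq]
      field_simp
      ring
    have e' : μ * (L * μ ^ ν * ‖u‖ ^ (1 + ν) + 2 * (δ / μ)) =
        L * (μ * μ ^ ν * ‖u‖ ^ (1 + ν)) + δ + δ := by
      field_simp
      ring
    rw [e, e']
    exact (abs_add_le _ _).trans (add_le_add ((abs_sub _ _).trans (add_le_add h1 h3)) h2)
  rw [abs_mul, abs_of_pos hμ] at hμq
  have hqle := le_of_mul_le_mul_left hμq hμ
  have hsq : q ^ 2 ≤ 2 * (L * μ ^ ν * ‖u‖ ^ (1 + ν)) ^ 2 + 8 * (δ / μ) ^ 2 := by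
    rw [← sq_abs q]
    calc |q| ^ 2 ≤ (L * μ ^ ν * ‖u‖ ^ (1 + ν) + 2 * (δ / μ)) ^ 2 := by gcongr
      _ ≤ _ := by nlinarith [sq_nonneg (L * μ ^ ν * ‖u‖ ^ (1 + ν) - 2 * (δ / μ))]
  -- Normalizing by `E‖u‖² = n` trades the fractional power for a fourth power without losing the
  -- order in `n`.
  have hpow : (‖u‖ ^ (1 + ν)) ^ 2 ≤ (n : ℝ) ^ (1 + ν) * (1 + ‖u‖ ^ 4 / n ^ 2) := by
    have h := Real.rpow_one_add_le_one_add_sq (t := ‖u‖ ^ 2 / n) (by positivity) hν₀.le hν₁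
    rw [Real.div_rpow (by positivity) hn0.le, div_le_iff₀ (by positivity)] at h
    calc (‖u‖ ^ (1 + ν)) ^ 2 = (‖u‖ ^ 2) ^ (1 + ν) := by
          rw [← Real.rpow_natCast, ← Real.rpow_natCast, ← Real.rpow_mul (norm_nonneg u),
            ← Real.rpow_mul (norm_nonneg u), mul_comm]
      _ ≤ _ := h
      _ = _ := by ring
  have hμν : (μ ^ ν) ^ 2 = μ ^ (2 * ν) := by
    rw [← Real.rpow_natCast, ← Real.rpow_mul hμ.le]
    ring_nf
  calc q ^ 2 ≤ 2 * (L * μ ^ ν * ‖u‖ ^ (1 + ν)) ^ 2 + 8 * (δ / μ) ^ 2 := hsq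
    _ = 2 * (L ^ 2 * μ ^ (2 * ν)) * (‖u‖ ^ (1 + ν)) ^ 2 + 8 * (δ / μ) ^ 2 * 1 := by
      rw [mul_pow, mul_pow, hμν]
      ring
    _ ≤ 2 * (L ^ 2 * μ ^ (2 * ν)) * ((n : ℝ) ^ (1 + ν) * (1 + ‖u‖ ^ 4 / n ^ 2)) +
        8 * (δ / μ) ^ 2 * (1 + ‖u‖ ^ 4 / n ^ 2) := by
      gcongr
      linarith [show (0 : ℝ) ≤ ‖u‖ ^ 4 / n ^ 2 by positivity]
    _ = _ := by
      rw [smoothingError]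
      ring

variable [FiniteDimensional ℝ E]

/-- One step of the method from `x` in the direction `u`. -/
noncomputable def gdStep (ftil : E → ℝ) (μ h : ℝ) (x u : E) : E :=
  x - h • (InnerProductSpace.toDual ℝ E).symm (gradEstimator ftil μ x u)

lemma gdStep_eq (ftil : E → ℝ) (μ h : ℝ) (x u : E) :
    gdStep ftil μ h x u = x - h • ((ftil (x + μ • u) - ftil x) / μ) • u := by
  simp [gdStep, gradEstimator]

/-- A pointwise upper bound for the value of `f` after one step of the method. -/
noncomputable def stepBound (f : E → ℝ) (h D M : ℝ) (n : ℕ) (x u : E) : ℝ :=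
  f x - 3 / 4 * h * fderiv ℝ f x u ^ 2 + h * D * (1 + ‖u‖ ^ 4 / n ^ 2) +
    h / (40 * n) * (fderiv ℝ f x u ^ 2 * ‖u‖ ^ 2 + D * (‖u‖ ^ 2 + ‖u‖ ^ 6 / n ^ 2)) + 400 * h * M

lemma apply_gdStep_le_stepBound (hf : HasHolderGradient f ν L)
    (ho : IsInexactOracle f ftil δ) (hν₀ : 0 < ν) (hν₁ : ν ≤ 1) (hL : 0 < L) (hμ : 0 < μ)
    (hn : 1 ≤ n) (x u : E) :
    f (gdStep ftil μ (stepSize ν L μ n) x u) ≤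
      stepBound f (stepSize ν L μ n) (2 * smoothingError ν L μ n + 8 * (δ / μ) ^ 2)
        (smoothingError ν L μ n) n x u := by
  have hn0 : (0 : ℝ) < n := by exact_mod_cast hn
  have hr := sq_differenceQuotient_sub_fderiv_le hf ho hν₀ hν₁ hL hμ hn x u
  rw [gdStep_eq, stepBound]
  set q := (ftil (x + μ • u) - ftil x) / μ with hq
  set h := stepSize ν L μ n with hh
  set D := 2 * smoothingError ν L μ n + 8 * (δ / μ) ^ 2 with hD
  have hpos : 0 < h := stepSize_pos hL hμ hn
  have h1 := (abs_le.1 (hf.abs_sub_le hν₀ hL.le x (x - h • q • u))).2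
  rw [sub_sub_cancel_left, map_neg, map_smul, map_smul, norm_neg, norm_smul,
    Real.norm_of_nonneg hpos.le, smul_eq_mul, smul_eq_mul] at h1
  have h2 := holder_term_le_of_stepSize hν₀ hν₁ hL hμ hn (norm_nonneg (q • u))
  rw [← hh] at h2
  have h3 : ‖q • u‖ ^ 2 ≤ 2 * (fderiv ℝ f x u ^ 2 * ‖u‖ ^ 2 + D * (‖u‖ ^ 2 + ‖u‖ ^ 6 / n ^ 2)) := by
    rw [norm_smul, mul_pow, Real.norm_eq_abs, sq_abs]
    calc q ^ 2 * ‖u‖ ^ 2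
        ≤ 2 * (fderiv ℝ f x u ^ 2 + (q - fderiv ℝ f x u) ^ 2) * ‖u‖ ^ 2 := by
          gcongr
          nlinarith [sq_nonneg (2 * fderiv ℝ f x u - q)]
      _ ≤ 2 * (fderiv ℝ f x u ^ 2 + D * (1 + ‖u‖ ^ 4 / n ^ 2)) * ‖u‖ ^ 2 := by gcongr
      _ = _ := by ring
  have h4 : h / (80 * n) * ‖q • u‖ ^ 2 ≤ h / (40 * n) *
      (fderiv ℝ f x u ^ 2 * ‖u‖ ^ 2 + D * (‖u‖ ^ 2 + ‖u‖ ^ 6 / n ^ 2)) := by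
    calc _ ≤ h / (80 * n) *
      (2 * (fderiv ℝ f x u ^ 2 * ‖u‖ ^ 2 + D * (‖u‖ ^ 2 + ‖u‖ ^ 6 / n ^ 2))) := by gcongr
      _ = _ := by
        field_simp
        ring
  -- `qφ ≥ (3/4)φ² - (q - φ)²`, the difference being `(q - φ/2)²`.
  have h5 : 3 / 4 * h * fderiv ℝ f x u ^ 2 - h * D * (1 + ‖u‖ ^ 4 / n ^ 2) ≤
      h * (q * fderiv ℝ f x u) := by
    calc _ = h * (3 / 4 * fderiv ℝ f x u ^ 2 - D * (1 + ‖u‖ ^ 4 / n ^ 2)) := by ring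
      _ ≤ _ := by
        gcongr
        nlinarith [sq_nonneg (q - fderiv ℝ f x u + fderiv ℝ f x u / 2)]
  linarith

variable [MeasurableSpace E] [BorelSpace E]

lemma integrable_stepBound (f : E → ℝ) (h D M : ℝ) (n : ℕ) (x : E) :
    Integrable (stepBound f h D M n x) (stdGaussian E) := by
  unfold stepBound
  have i1 := integrable_dual_pow_stdGaussian (fderiv ℝ f x) 2
  have i2 := integrable_dual_pow_mul_norm_pow_stdGaussian (fderiv ℝ f x) 2 2
  have i3 := integrable_norm_pow_stdGaussian (E := E)
  exact ((((integrable_const _).sub (i1.const_mul _)).add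
    (((integrable_const _).add ((i3 4).div_const _)).const_mul _)).add
    ((i2.add (((i3 2).add ((i3 6).div_const _)).const_mul _)).const_mul _)).add
    (integrable_const _)

lemma integral_stepBound_le (f : E → ℝ) {h D M : ℝ} (hh : 0 ≤ h) (hD : 0 ≤ D)
    (hn : 1 ≤ n) (hE : Module.finrank ℝ E = n) (x : E) :
    ∫ u, stepBound f h D M n x u ∂(stdGaussian E) ≤
      f x - h / 2 * ‖fderiv ℝ f x‖ ^ 2 + h * (5 * D + 400 * M) := by
  have hn0 : (0 : ℝ) < n := by exact_mod_cast hn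
  have i1 := integrable_dual_pow_stdGaussian (fderiv ℝ f x) 2
  have i2 := integrable_dual_pow_mul_norm_pow_stdGaussian (fderiv ℝ f x) 2 2
  have i3 := integrable_norm_pow_stdGaussian (E := E)
  have e : ∫ u, stepBound f h D M n x u ∂(stdGaussian E) =
      f x - 3 / 4 * h * ∫ u, fderiv ℝ f x u ^ 2 ∂(stdGaussian E) +
      h * D * (1 + (∫ u : E, ‖u‖ ^ 4 ∂(stdGaussian E)) / n ^ 2) +
      h / (40 * n) * ((∫ u, fderiv ℝ f x u ^ 2 * ‖u‖ ^ 2 ∂(stdGaussian E)) +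
        D * ((∫ u : E, ‖u‖ ^ 2 ∂(stdGaussian E)) +
          (∫ u : E, ‖u‖ ^ 6 ∂(stdGaussian E)) / n ^ 2)) + 400 * h * M := by
    unfold stepBound
    have j0 : Integrable (fun _ : E => f x) (stdGaussian E) := integrable_const _
    have j1 : Integrable (fun u => 3 / 4 * h * fderiv ℝ f x u ^ 2) (stdGaussian E) :=
      i1.const_mul _
    have j4 : Integrable (fun u : E => ‖u‖ ^ 4 / (n : ℝ) ^ 2) (stdGaussian E) := (i3 4).div_const _
    have j2 : Integrable (fun u : E => h * D * (1 + ‖u‖ ^ 4 / n ^ 2)) (stdGaussian E) :=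
      ((integrable_const _).add j4).const_mul _
    have j6 : Integrable (fun u : E => ‖u‖ ^ 6 / (n : ℝ) ^ 2) (stdGaussian E) := (i3 6).div_const _
    have j5 : Integrable (fun u : E => D * (‖u‖ ^ 2 + ‖u‖ ^ 6 / n ^ 2)) (stdGaussian E) :=
      ((i3 2).add j6).const_mul _
    have j3 : Integrable (fun u => h / (40 * n) *
        (fderiv ℝ f x u ^ 2 * ‖u‖ ^ 2 + D * (‖u‖ ^ 2 + ‖u‖ ^ 6 / n ^ 2))) (stdGaussian E) :=
      (i2.add j5).const_mul _
    have k1 : Integrable (fun u => f x - 3 / 4 * h * fderiv ℝ f x u ^ 2) (stdGaussian E) :=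
      j0.sub j1
    have k2 : Integrable (fun u => f x - 3 / 4 * h * fderiv ℝ f x u ^ 2 +
        h * D * (1 + ‖u‖ ^ 4 / n ^ 2)) (stdGaussian E) := k1.add j2
    have k3 : Integrable (fun u => f x - 3 / 4 * h * fderiv ℝ f x u ^ 2 +
        h * D * (1 + ‖u‖ ^ 4 / n ^ 2) + h / (40 * n) *
        (fderiv ℝ f x u ^ 2 * ‖u‖ ^ 2 + D * (‖u‖ ^ 2 + ‖u‖ ^ 6 / n ^ 2))) (stdGaussian E) :=
      k2.add j3
    rw [integral_add k3 (integrable_const _), integral_add k2 j3, integral_add k1 j2,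
      integral_sub j0 j1, integral_const_mul, integral_const_mul, integral_const_mul,
      integral_add (integrable_const _) j4, integral_add i2 j5,
      integral_const_mul, integral_add (i3 2) j6, integral_div, integral_div]
    simp
  have m2 := integral_norm_pow_stdGaussian_le (E := E) 0
  have m4 := integral_norm_pow_stdGaussian_le (E := E) 1
  have m6 := integral_norm_pow_stdGaussian_le (E := E) 2
  have mφ := integral_dual_sq_mul_norm_sq_stdGaussian_le (fderiv ℝ f x)
  simp only [hE, Nat.doubleFactorial, zero_add, mul_one, Nat.reduceAdd, Nat.reduceMul,
    Nat.reduceSub, pow_one, Nat.cast_one, one_mul, Nat.cast_ofNat] at m2 m4 m6 mφ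
  rw [e, integral_dual_sq_stdGaussian]
  calc _ ≤ f x - 3 / 4 * h * ‖fderiv ℝ f x‖ ^ 2 + h * D * (1 + (3 * (n : ℝ) ^ 2) / n ^ 2) +
        h / (40 * n) * (3 * n * ‖fderiv ℝ f x‖ ^ 2 + D * (n + (15 * n ^ 3) / n ^ 2)) +
          400 * h * M := by gcongr
    -- Here `27/40 = 3/4 - 3/40` and `22/5 = (1 + 3) + (1 + 15)/40`.
    _ = f x - 27 / 40 * (h * ‖fderiv ℝ f x‖ ^ 2) + 22 / 5 * (h * D) + 400 * h * M := by
        field_simp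
        ring
    _ ≤ _ := by
        nlinarith [mul_nonneg hh hD, mul_nonneg hh (sq_nonneg ‖fderiv ℝ f x‖)]

/-- Expected decrease in one step, in a form that presupposes no integrability. -/
lemma lintegral_apply_gdStep_add_le (hf : HasHolderGradient f ν L)
    (ho : IsInexactOracle f ftil δ) (hν₀ : 0 < ν) (hν₁ : ν ≤ 1) (hL : 0 < L) (hμ : 0 < μ)
    (hn : 1 ≤ n) (hE : Module.finrank ℝ E = n) {m : ℝ} (hm : ∀ x, m ≤ f x) (x : E) :
    ∫⁻ u, ENNReal.ofReal (f (gdStep ftil μ (stepSize ν L μ n) x u) - m) ∂(stdGaussian E) +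
        ENNReal.ofReal (stepSize ν L μ n / 2 * ‖fderiv ℝ f x‖ ^ 2) ≤
      ENNReal.ofReal (f x - m) + ENNReal.ofReal (stepSize ν L μ n *
        (410 * smoothingError ν L μ n + 40 * (δ / μ) ^ 2)) := by
  have hpos : 0 < stepSize ν L μ n := stepSize_pos hL hμ hn
  have hM : 0 ≤ smoothingError ν L μ n := smoothingError_nonneg hμ
  set B := stepBound f (stepSize ν L μ n) (2 * smoothingError ν L μ n + 8 * (δ / μ) ^ 2)
        (smoothingError ν L μ n) n x with hB
  have hle : ∀ u, f (gdStep ftil μ (stepSize ν L μ n) x u) ≤ B u :=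
    apply_gdStep_le_stepBound hf ho hν₀ hν₁ hL hμ hn x
  have hBint : Integrable (fun u => B u - m) (stdGaussian E) :=
    (integrable_stepBound _ _ _ _ _ _).sub (integrable_const _)
  have hB0 : ∀ u, 0 ≤ B u - m := fun u => sub_nonneg.2 ((hm _).trans (hle u))
  calc _ ≤ ∫⁻ u, ENNReal.ofReal (B u - m) ∂(stdGaussian E) +
        ENNReal.ofReal (stepSize ν L μ n / 2 * ‖fderiv ℝ f x‖ ^ 2) := by
        gcongr with u
        exact hle u
    _ = ENNReal.ofReal ((∫ u, B u - m ∂(stdGaussian E)) +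
          stepSize ν L μ n / 2 * ‖fderiv ℝ f x‖ ^ 2) := by
        rw [← ofReal_integral_eq_lintegral_ofReal hBint (ae_of_all _ hB0),
          ENNReal.ofReal_add (integral_nonneg hB0) (by positivity)]
    _ ≤ ENNReal.ofReal ((f x - m) + stepSize ν L μ n *
        (410 * smoothingError ν L μ n + 40 * (δ / μ) ^ 2)) := by
        apply ENNReal.ofReal_le_ofReal
        have h := integral_stepBound_le f hpos.le
          (by positivity : 0 ≤ 2 * smoothingError ν L μ n + 8 * (δ / μ) ^ 2)
          (M := smoothingError ν L μ n) hn hE x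
        rw [integral_sub (integrable_stepBound _ _ _ _ _ _) (integrable_const _)]
        simp only [integral_const, probReal_univ, one_smul]
        linarith
    _ ≤ _ := ENNReal.ofReal_add_le

end OneStep

end ZerothOrder

namespace ZerothOrder

/-! ### Independence and telescoping along the process -/

section Iterates

variable {E : Type*} [NormedAddCommGroup E] [InnerProductSpace ℝ E] [FiniteDimensional ℝ E]
  {f ftil : E → ℝ} {ν L μ h δ : ℝ} {n : ℕ} {x₀ : E}

lemma gdProcess_succ (ftil : E → ℝ) (μ h : ℝ) (x₀ : E) (u : ℕ → E) (k : ℕ) :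
    gdProcess ftil μ h x₀ u (k + 1) = gdStep ftil μ h (gdProcess ftil μ h x₀ u k) (u k) := rfl

lemma gdProcess_congr {u v : ℕ → E} : ∀ {k : ℕ}, (∀ j < k, u j = v j) →
    gdProcess ftil μ h x₀ u k = gdProcess ftil μ h x₀ v k
  | 0, _ => rfl
  | k + 1, huv => by
    rw [gdProcess_succ, gdProcess_succ, huv k k.lt_succ_self,
      gdProcess_congr fun j hj => huv j (hj.trans k.lt_succ_self)]

variable [MeasurableSpace E] [BorelSpace E]

lemma measurable_gdStep (hft : Measurable ftil) :
    Measurable fun p : E × E => gdStep ftil μ h p.1 p.2 := by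
  simp_rw [gdStep_eq]
  fun_prop

lemma measurable_gdProcess (hft : Measurable ftil) (k : ℕ) :
    Measurable fun v : ℕ → E => gdProcess ftil μ h x₀ v k := by
  induction k with
  | zero => exact measurable_const
  | succ k ih => exact (measurable_gdStep hft).comp (ih.prodMk (measurable_pi_apply k))

variable {Ω : Type*} [MeasurableSpace Ω] {P : Measure Ω} {u : ℕ → Ω → E}

lemma aemeasurable_gdProcess (hft : Measurable ftil) (hu : ∀ k, AEMeasurable (u k) P) (k : ℕ) :
    AEMeasurable (fun ω => gdProcess ftil μ h x₀ (fun j => u j ω) k) P :=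
  (measurable_gdProcess hft k).comp_aemeasurable (aemeasurable_pi_iff.2 hu)

/-- The `k`-th iterate is a measurable function of the directions before `k` alone. -/
lemma indepFun_gdProcess (hft : Measurable ftil) (hind : iIndepFun u P)
    (hu : ∀ k, AEMeasurable (u k) P) (k : ℕ) :
    IndepFun (fun ω => gdProcess ftil μ h x₀ (fun j => u j ω) k) (u k) P := by
  have h1 := hind.indepFun_finset₀ (Finset.range k) {k} (by simp) hu
  -- Padding by `0` is harmless: iterate `k` never reads coordinates from `k` on.
  let extend : (Finset.range k → E) → ℕ → E := fun v j =>
    if hj : j ∈ Finset.range k then v ⟨j, hj⟩ else 0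
  have hext : Measurable extend := by
    refine measurable_pi_iff.2 fun j => ?_
    by_cases hj : j ∈ Finset.range k
    · simp only [extend, hj, dite_true]
      fun_prop
    · simp only [extend, hj, dite_false]
      fun_prop
  have hlast : Measurable fun v : ({k} : Finset ℕ) → E => v ⟨k, Finset.mem_singleton_self k⟩ :=
    measurable_pi_apply _
  have h2 := h1.comp ((measurable_gdProcess (μ := μ) (h := h) (x₀ := x₀) hft k).comp hext) hlast
  refine h2.congr (ae_of_all _ fun ω => gdProcess_congr fun j hj => ?_) (ae_of_all _ fun ω => rfl)
  simp [extend, hj]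

variable [IsProbabilityMeasure P]

/-- By independence `(x_k, u_k)` has a product law, so Tonelli applies the one-step bound at each
fixed `x_k`. -/
lemma lintegral_gdProcess_succ_add_le (hf : HasHolderGradient f ν L) (hft : Measurable ftil)
    (ho : IsInexactOracle f ftil δ) (hν₀ : 0 < ν) (hν₁ : ν ≤ 1) (hL : 0 < L) (hμ : 0 < μ)
    (hn : 1 ≤ n) (hE : Module.finrank ℝ E = n) {m : ℝ} (hm : ∀ x, m ≤ f x)
    (hind : iIndepFun u P) (hu : ∀ k, HasLaw (u k) (stdGaussian E) P) (k : ℕ) :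
    let x := fun k ω => gdProcess ftil μ (stepSize ν L μ n) x₀ (fun j => u j ω) k
    ∫⁻ ω, ENNReal.ofReal (f (x (k + 1) ω) - m) ∂P +
        ∫⁻ ω, ENNReal.ofReal (stepSize ν L μ n / 2 * ‖fderiv ℝ f (x k ω)‖ ^ 2) ∂P ≤
      ∫⁻ ω, ENNReal.ofReal (f (x k ω) - m) ∂P + ENNReal.ofReal (stepSize ν L μ n *
        (410 * smoothingError ν L μ n + 40 * (δ / μ) ^ 2)) := by
  intro x
  have hum : ∀ k, AEMeasurable (u k) P := fun k => (hu k).aemeasurable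
  have hx : AEMeasurable (x k) P := aemeasurable_gdProcess hft hum k
  have hfm : Measurable f := hf.1.continuous.measurable
  have hlaw : P.map (fun ω => (x k ω, u k ω)) = (P.map (x k)).prod (stdGaussian E) := by
    rw [(indepFun_iff_map_prod_eq_prod_map_map hx (hum k)).1 (indepFun_gdProcess hft hind hum k),
      (hu k).map_eq]
  have hG : Measurable fun p : E × E =>
      ENNReal.ofReal (f (gdStep ftil μ (stepSize ν L μ n) p.1 p.2) - m) :=
    ((hfm.comp (measurable_gdStep hft)).sub_const m).ennreal_ofReal
  have hd : Measurable fun y => ENNReal.ofReal (stepSize ν L μ n / 2 * ‖fderiv ℝ f y‖ ^ 2) :=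
    (((measurable_fderiv ℝ f).norm.pow_const 2).const_mul _).ennreal_ofReal
  have h1 : ∫⁻ ω, ENNReal.ofReal (f (x (k + 1) ω) - m) ∂P =
      ∫⁻ y, ∫⁻ v, ENNReal.ofReal (f (gdStep ftil μ (stepSize ν L μ n) y v) - m)
        ∂(stdGaussian E) ∂(P.map (x k)) := by
    rw [← lintegral_prod _ hG.aemeasurable, ← hlaw,
      lintegral_map' hG.aemeasurable (hx.prodMk (hum k))]
    rfl
  rw [h1, ← lintegral_map' hd.aemeasurable hx,
    ← lintegral_map' (f := fun y => ENNReal.ofReal (f y - m))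
      (hfm.sub_const m).ennreal_ofReal.aemeasurable hx, ← lintegral_add_right _ hd]
  have := Measure.isProbabilityMeasure_map hx
  calc _ ≤ ∫⁻ y, (ENNReal.ofReal (f y - m) + ENNReal.ofReal (stepSize ν L μ n *
        (410 * smoothingError ν L μ n + 40 * (δ / μ) ^ 2))) ∂(P.map (x k)) :=
        lintegral_mono fun y =>
          lintegral_apply_gdStep_add_le hf ho hν₀ hν₁ hL hμ hn hE hm y
    _ = _ := by
        rw [lintegral_add_right _ measurable_const]
        simp

/-- The expected squared gradient norms along the process are finite, and their sum is controlled
by the initial gap and the accumulated error. -/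
lemma integrable_and_sum_integral_le (hf : HasHolderGradient f ν L) (hft : Measurable ftil)
    (ho : IsInexactOracle f ftil δ) (hν₀ : 0 < ν) (hν₁ : ν ≤ 1) (hL : 0 < L) (hμ : 0 < μ)
    (hn : 1 ≤ n) (hE : Module.finrank ℝ E = n) {m : ℝ} (hm : ∀ x, m ≤ f x)
    (hind : iIndepFun u P) (hu : ∀ k, HasLaw (u k) (stdGaussian E) P) :
    let G := fun k ω => ‖fderiv ℝ f
      (gdProcess ftil μ (stepSize ν L μ n) x₀ (fun j => u j ω) k)‖ ^ 2
    (∀ k, Integrable (G k) P) ∧ ∀ N : ℕ,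
      stepSize ν L μ n / 2 * ∑ k ∈ Finset.range N, ∫ ω, G k ω ∂P ≤
        f x₀ - m + N * (stepSize ν L μ n *
          (410 * smoothingError ν L μ n + 40 * (δ / μ) ^ 2)) := by
  intro G
  have hpos : 0 < stepSize ν L μ n := stepSize_pos hL hμ hn
  have hM : 0 ≤ smoothingError ν L μ n := smoothingError_nonneg hμ
  set h := stepSize ν L μ n with hh
  set R := h * (410 * smoothingError ν L μ n + 40 * (δ / μ) ^ 2) with hR
  have hR0 : 0 ≤ R := by positivity
  set x := fun k ω => gdProcess ftil μ h x₀ (fun j => u j ω) k with hx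
  have hGm : ∀ k, AEMeasurable (G k) P := fun k =>
    ((measurable_fderiv ℝ f).norm.pow_const 2).comp_aemeasurable
      (aemeasurable_gdProcess hft (fun k => (hu k).aemeasurable) k)
  have hstep : ∀ k, ∫⁻ ω, ENNReal.ofReal (f (x (k + 1) ω) - m) ∂P +
      ∫⁻ ω, ENNReal.ofReal (h / 2 * G k ω) ∂P ≤
      ∫⁻ ω, ENNReal.ofReal (f (x k ω) - m) ∂P + ENNReal.ofReal R :=
    lintegral_gdProcess_succ_add_le hf hft ho hν₀ hν₁ hL hμ hn hE hm hind hu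
  -- Telescoping in `ENNReal`, so integrability of the gradients is a consequence and not an
  -- assumption.
  have hsum : ∀ N : ℕ, ∫⁻ ω, ENNReal.ofReal (f (x N ω) - m) ∂P +
      ∑ k ∈ Finset.range N, ∫⁻ ω, ENNReal.ofReal (h / 2 * G k ω) ∂P ≤
      ENNReal.ofReal (f x₀ - m + N * R) := by
    intro N
    induction N with
    | zero => simp [hx, gdProcess]
    | succ N ih =>
      rw [Finset.sum_range_succ]
      calc _ = (∫⁻ ω, ENNReal.ofReal (f (x (N + 1) ω) - m) ∂P +
              ∫⁻ ω, ENNReal.ofReal (h / 2 * G N ω) ∂P) +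
            ∑ k ∈ Finset.range N, ∫⁻ ω, ENNReal.ofReal (h / 2 * G k ω) ∂P := by ring
        _ ≤ (∫⁻ ω, ENNReal.ofReal (f (x N ω) - m) ∂P + ENNReal.ofReal R) +
            ∑ k ∈ Finset.range N, ∫⁻ ω, ENNReal.ofReal (h / 2 * G k ω) ∂P := by
          exact add_le_add_left (hstep N) _
        _ = (∫⁻ ω, ENNReal.ofReal (f (x N ω) - m) ∂P +
            ∑ k ∈ Finset.range N, ∫⁻ ω, ENNReal.ofReal (h / 2 * G k ω) ∂P) +
              ENNReal.ofReal R := by ring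
        _ ≤ ENNReal.ofReal (f x₀ - m + N * R) + ENNReal.ofReal R := by gcongr
        _ = _ := by
          rw [← ENNReal.ofReal_add (add_nonneg (sub_nonneg.2 (hm _)) (by positivity)) hR0]
          push_cast
          ring_nf
  have hsum' : ∀ N : ℕ, ∑ k ∈ Finset.range N, ∫⁻ ω, ENNReal.ofReal (h / 2 * G k ω) ∂P ≤
      ENNReal.ofReal (f x₀ - m + N * R) := fun N => le_add_self.trans (hsum N)
  have hnonneg : ∀ k ω, 0 ≤ h / 2 * G k ω := fun k ω => by positivity
  have hint : ∀ k, Integrable (fun ω => h / 2 * G k ω) P := fun k => by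
    refine ⟨((hGm k).const_mul _).aestronglyMeasurable, ?_⟩
    rw [hasFiniteIntegral_iff_ofReal (ae_of_all _ (hnonneg k))]
    exact ((Finset.single_le_sum (f := fun k => ∫⁻ ω, ENNReal.ofReal (h / 2 * G k ω) ∂P)
      (fun _ _ => zero_le) (Finset.self_mem_range_succ k)).trans
      (hsum' (k + 1))).trans_lt ENNReal.ofReal_lt_top
  refine ⟨fun k => ?_, fun N => ?_⟩
  · exact (integrable_const_mul_iff (IsUnit.mk0 _ (by positivity)) _).1 (hint k)
  · have hN := hsum' N
    simp_rw [← ofReal_integral_eq_lintegral_ofReal (hint _) (ae_of_all _ (hnonneg _))] at hN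
    rw [← ENNReal.ofReal_sum_of_nonneg fun k _ => integral_nonneg (hnonneg k),
      ENNReal.ofReal_le_ofReal_iff (add_nonneg (sub_nonneg.2 (hm _)) (by positivity))] at hN
    simpa only [integral_const_mul, ← Finset.mul_sum] using hN

lemma exists_integral_le_of_steps (hf : HasHolderGradient f ν L) (hft : Measurable ftil)
    (ho : IsInexactOracle f ftil δ) (hν₀ : 0 < ν) (hν₁ : ν ≤ 1) (hL : 0 < L) (hμ : 0 < μ)
    (hn : 1 ≤ n) (hE : Module.finrank ℝ E = n) {m : ℝ} (hm : ∀ x, m ≤ f x)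
    (hind : iIndepFun u P) (hu : ∀ k, HasLaw (u k) (stdGaussian E) P) {ε : ℝ} {N : ℕ}
    (herr : 410 * smoothingError ν L μ n + 40 * (δ / μ) ^ 2 ≤ ε / 4)
    (hN₀ : 0 < N) (hN : 4 * (f x₀ - m) ≤ N * (stepSize ν L μ n * ε)) :
    ∃ k < N, ∫ ω, ‖fderiv ℝ f
      (gdProcess ftil μ (stepSize ν L μ n) x₀ (fun j => u j ω) k)‖ ^ 2 ∂P ≤ ε := by
  have hpos : 0 < stepSize ν L μ n := stepSize_pos hL hμ hn
  have h := (integrable_and_sum_integral_le (x₀ := x₀) hf hft ho hν₀ hν₁ hL hμ hn hE hm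
    hind hu).2 N
  have hsum : ∑ k ∈ Finset.range N, ∫ ω, ‖fderiv ℝ f
      (gdProcess ftil μ (stepSize ν L μ n) x₀ (fun j => u j ω) k)‖ ^ 2 ∂P ≤
      ∑ k ∈ Finset.range N, ε := by
    rw [Finset.sum_const, Finset.card_range, nsmul_eq_mul]
    -- The initial gap and the accumulated error each use at most `N h ε / 4` of the available `N h
    -- ε / 2`.
    refine le_of_mul_le_mul_left (h.trans ?_) (half_pos hpos)
    have : (N : ℝ) * (stepSize ν L μ n *
        (410 * smoothingError ν L μ n + 40 * (δ / μ) ^ 2)) ≤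
        N * (stepSize ν L μ n * (ε / 4)) := by gcongr
    linarith
  obtain ⟨k, hk, hle⟩ := Finset.exists_le_of_sum_le ⟨0, Finset.mem_range.2 hN₀⟩ hsum
  exact ⟨k, Finset.mem_range.1 hk, hle⟩

end Iterates

end ZerothOrder

namespace ZerothOrder

/-- The smoothing parameter of order `ε ^ (1 / (2 ν)) / n ^ ((1 + ν) / (2 ν))`. -/
noncomputable def smoothing (κ ν : ℝ) (n : ℕ) (ε : ℝ) : ℝ :=
  (κ * ε / (n : ℝ) ^ (1 + ν)) ^ (1 / (2 * ν))

/-! ### Orders of the parameters -/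

section Parameters

variable {κ ν L ε εmax : ℝ} {n : ℕ}

lemma smoothing_pos (hκ : 0 < κ) (hε : 0 < ε) (hn : 1 ≤ n) : 0 < smoothing κ ν n ε := by
  have : (0 : ℝ) < n := by exact_mod_cast hn
  unfold smoothing
  positivity

lemma smoothing_rpow (hκ : 0 < κ) (hε : 0 < ε) (p : ℝ) :
    smoothing κ ν n ε ^ p = (κ * ε) ^ (p / (2 * ν)) / (n : ℝ) ^ ((1 + ν) * (p / (2 * ν))) := by
  unfold smoothing
  rw [← Real.rpow_mul (by positivity), one_div_mul_eq_div, Real.div_rpow (by positivity)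
    (by positivity), ← Real.rpow_mul (by positivity)]

lemma smoothing_rpow_two_mul (hν : 0 < ν) (hκ : 0 < κ) (hε : 0 < ε) :
    smoothing κ ν n ε ^ (2 * ν) = κ * ε / (n : ℝ) ^ (1 + ν) := by
  rw [smoothing_rpow hκ hε, div_self (by positivity), Real.rpow_one, mul_one]

lemma smoothing_lt_one (hν : 0 < ν) (hκ : 0 < κ) (hε : 0 < ε) (hn : 1 ≤ n) (hκε : κ * ε < 1) :
    smoothing κ ν n ε < 1 := by
  have hn1 : (1 : ℝ) ≤ n := by exact_mod_cast hn
  refine Real.rpow_lt_one (by positivity) ?_ (by positivity)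
  exact (div_le_self (by positivity) (Real.one_le_rpow hn1 (by linarith))).trans_lt hκε

lemma smoothingError_smoothing (hν : 0 < ν) (hκ : 0 < κ) (hε : 0 < ε) (hn : 1 ≤ n) :
    smoothingError ν L (smoothing κ ν n ε) n = L ^ 2 * (κ * ε) := by
  have : (0 : ℝ) < n := by exact_mod_cast hn
  rw [smoothingError, smoothing_rpow_two_mul hν hκ hε]
  field_simp

lemma noiseLevel_smoothing (hν : 0 < ν) (hκ : 0 < κ) (hε : 0 < ε) (hn : 1 ≤ n) :
    noiseLevel ν (smoothing κ ν n ε) n = κ ^ ((3 + ν) / (4 * ν)) * noiseOrder ν ε n := by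
  have hn0 : (0 : ℝ) < n := by exact_mod_cast hn
  rw [noiseLevel, noiseOrder, smoothing_rpow hκ hε, div_div, ← Real.rpow_add hn0,
    show (3 + ν) / 2 / (2 * ν) = (3 + ν) / (4 * ν) by field_simp; norm_num,
    show (1 + ν) * ((3 + ν) / (4 * ν)) + (3 - ν) / 4 = (3 + 7 * ν) / (4 * ν) by field_simp; ring,
    Real.mul_rpow hκ.le hε.le, mul_div_assoc]

/-- The noise level gives `(δ/μ)² ≤ μ^(1+ν)`, and `2ν ≤ 1 + ν` with `μ ≤ 1`. -/
lemma sq_div_le_of_le_noiseLevel {μ δ : ℝ} (hν₁ : ν ≤ 1) (hμ₀ : 0 < μ) (hμ₁ : μ ≤ 1)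
    (hn : 1 ≤ n) (hδ₀ : 0 ≤ δ) (hδ : δ ≤ noiseLevel ν μ n) : (δ / μ) ^ 2 ≤ μ ^ (2 * ν) := by
  have hn1 : (1 : ℝ) ≤ n := by exact_mod_cast hn
  have h1 : δ ≤ μ ^ ((3 + ν) / 2) :=
    hδ.trans (div_le_self (by positivity) (Real.one_le_rpow hn1 (by linarith)))
  calc (δ / μ) ^ 2 ≤ (μ ^ ((3 + ν) / 2) / μ) ^ 2 := by gcongr
    _ = μ ^ (1 + ν) := by
      rw [← Real.rpow_sub_one hμ₀.ne', ← Real.rpow_natCast, ← Real.rpow_mul hμ₀.le]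
      push_cast
      ring_nf
    _ ≤ _ := Real.rpow_le_rpow_of_exponent_ge hμ₀ hμ₁ (by linarith)

/-- With `p = (1-ν)/(2ν)`, the left side has order `n^(2+p) / ε^(1+p)`, while `1/ν = 1 + 2p`. The
spare factor `ε^p` is bounded by `εmax^p`. -/
lemma one_div_stepSize_mul_le (hν₀ : 0 < ν) (hν₁ : ν ≤ 1) (hL : 0 < L) (hκ : 0 < κ) (hε : 0 < ε)
    (hεmax : ε ≤ εmax) (hn : 1 ≤ n) :
    1 / (stepSize ν L (smoothing κ ν n ε) n * ε) ≤
      400 * L * (εmax / κ) ^ ((1 - ν) / (2 * ν)) * stepsOrder ν ε n := by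
  have hn1 : (1 : ℝ) ≤ n := by exact_mod_cast hn
  have hn0 : (0 : ℝ) < n := by linarith
  set p := (1 - ν) / (2 * ν) with hp
  have hp0 : 0 ≤ p := div_nonneg (by linarith) (by linarith)
  have hνp : 2 * ν * p = 1 - ν := by
    rw [hp]
    field_simp
  have e1 : (n : ℝ) ^ (2 + p) = n * ((n : ℝ) ^ ((1 + ν) / 2) * (n : ℝ) ^ ((1 + ν) * p)) := by
    rw [← Real.rpow_add hn0, ← Real.rpow_one_add' hn0.le (by positivity)]
    congr 1
    linarith
  have e2 : ε ^ (1 / ν) = ε ^ p * ε ^ p * ε := by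
    rw [← Real.rpow_add hε, ← Real.rpow_add_one hε.ne']
    congr 1
    rw [hp]
    field_simp
    ring
  have e : 1 / (stepSize ν L (smoothing κ ν n ε) n * ε) =
      80 * ((n + 4) / n) * L * (ε / κ) ^ p * stepsOrder ν ε n := by
    rw [stepSize, stepsOrder, smoothing_rpow hκ hε, ← hp, e1, e2, Real.mul_rpow hκ.le hε.le,
      Real.div_rpow hε.le hκ.le]
    field_simp
  have h1 : ((n : ℝ) + 4) / n ≤ 5 := by
    rw [div_le_iff₀ hn0]
    linarith
  have h2 : 0 ≤ stepsOrder ν ε n := by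
    unfold stepsOrder
    positivity
  calc _ = _ := e
    _ ≤ 80 * 5 * L * (εmax / κ) ^ p * stepsOrder ν ε n := by gcongr
    _ = _ := by ring

/-- Lets additive constants from rounding `N` be absorbed into `C`. -/
lemma one_le_rpow_mul_stepsOrder (hν₀ : 0 < ν) (hν₁ : ν ≤ 1) (hε : 0 < ε) (hεmax : ε ≤ εmax)
    (hn : 1 ≤ n) : 1 ≤ εmax ^ (1 / ν) * stepsOrder ν ε n := by
  have hn1 : (1 : ℝ) ≤ n := by exact_mod_cast hn
  have h1 : ε ^ (1 / ν) ≤ εmax ^ (1 / ν) := by gcongr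
  have h2 : (1 : ℝ) ≤ (n : ℝ) ^ (2 + (1 - ν) / (2 * ν)) :=
    Real.one_le_rpow hn1 (add_nonneg zero_le_two (div_nonneg (by linarith) (by linarith)))
  rw [stepsOrder, ← mul_div_assoc, one_le_div (by positivity)]
  calc ε ^ (1 / ν) = ε ^ (1 / ν) * 1 := (mul_one _).symm
    _ ≤ _ := mul_le_mul h1 h2 zero_le_one (Real.rpow_nonneg (hε.le.trans hεmax) _)

end Parameters

end ZerothOrder

/-! ### Assembly -/

/-- Choice of constants: `ν`, `L` and an upper bound `εmax` on the accuracies are fixed. The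
smoothing parameter `μ n ε` depends on these and on `n` and `ε` only; the constant `C` in the number
of steps depends moreover on a bound `Δ` for `f x₀ - inf f`. Nothing depends on the space, the
function, the oracle, the starting point or the probability space. -/
theorem theorem1 (ν L εmax : ℝ) (hν₀ : 0 < ν) (hν₁ : ν ≤ 1) (hL : 0 < L) (hεmax : 0 < εmax) :
    ∃ (c₁ c₂ : ℝ) (μ : ℕ → ℝ → ℝ), 0 < c₁ ∧ 0 < c₂ ∧
      (∀ (n : ℕ) (ε : ℝ), 1 ≤ n → 0 < ε → ε ≤ εmax →
        0 < μ n ε ∧ μ n ε < 1 ∧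
        c₁ * ZerothOrder.noiseOrder ν ε n ≤ ZerothOrder.noiseLevel ν (μ n ε) n ∧
        ZerothOrder.noiseLevel ν (μ n ε) n ≤ c₂ * ZerothOrder.noiseOrder ν ε n) ∧
      ∀ Δ : ℝ, ∃ C : ℝ, 0 < C ∧ ∀ (n : ℕ) (ε : ℝ), 1 ≤ n → 0 < ε → ε ≤ εmax →
        ∃ N : ℕ, (N : ℝ) ≤ C * ZerothOrder.stepsOrder ν ε n ∧
          ∀ (E : Type*) [NormedAddCommGroup E] [InnerProductSpace ℝ E] [FiniteDimensional ℝ E]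
            [MeasurableSpace E] [BorelSpace E] (f ftil : E → ℝ) (δ : ℝ) (x₀ : E)
            (Ω : Type*) [MeasurableSpace Ω] (P : Measure Ω) [IsProbabilityMeasure P]
            (u : ℕ → Ω → E),
            Module.finrank ℝ E = n →
            ZerothOrder.HasHolderGradient f ν L →
            BddBelow (Set.range f) →
            f x₀ - (⨅ x, f x) ≤ Δ →
            Measurable ftil →
            ZerothOrder.IsInexactOracle f ftil δ →
            δ < ZerothOrder.noiseLevel ν (μ n ε) n →
            iIndepFun u P →
            (∀ k, HasLaw (u k) (stdGaussian E) P) →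
            (∀ k < N, Integrable (fun ω => ‖fderiv ℝ f (ZerothOrder.gdProcess ftil (μ n ε)
              (ZerothOrder.stepSize ν L (μ n ε) n) x₀ (fun j => u j ω) k)‖ ^ 2) P) ∧
            ∃ k < N, ∫ ω, ‖fderiv ℝ f (ZerothOrder.gdProcess ftil (μ n ε)
              (ZerothOrder.stepSize ν L (μ n ε) n) x₀ (fun j => u j ω) k)‖ ^ 2 ∂P ≤ ε := by
  -- The first summand of the denominator keeps the error below `ε/4`; the second gives `κ ε < 1`,
  -- hence `μ < 1`.
  set κ : ℝ := 1 / (4 * (410 * L ^ 2 + 40) + εmax) with hκdef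
  have hκ : 0 < κ := by positivity
  have hκ₁ : (410 * L ^ 2 + 40) * κ ≤ 1 / 4 := by
    rw [hκdef, mul_one_div, div_le_div_iff₀ (by positivity) (by norm_num)]
    linarith
  have hκ₂ : κ * εmax < 1 := by
    rw [hκdef, one_div_mul_eq_div, div_lt_one (by positivity)]
    linarith [sq_nonneg L]
  -- The noise level is exactly this constant times `noiseOrder`, so `c₁ = c₂`.
  refine ⟨κ ^ ((3 + ν) / (4 * ν)), κ ^ ((3 + ν) / (4 * ν)), ZerothOrder.smoothing κ ν,
    by positivity, by positivity, fun n ε hn hε hεm => ?_, fun Δ => ?_⟩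
  · refine ⟨ZerothOrder.smoothing_pos hκ hε hn,
      ZerothOrder.smoothing_lt_one hν₀ hκ hε hn ?_, ?_, ?_⟩
    · exact (mul_le_mul_of_nonneg_left hεm hκ.le).trans_lt hκ₂
    · exact (ZerothOrder.noiseLevel_smoothing hν₀ hκ hε hn).ge
    · exact (ZerothOrder.noiseLevel_smoothing hν₀ hκ hε hn).le
  set K := 400 * L * (εmax / κ) ^ ((1 - ν) / (2 * ν)) with hK
  have hK₀ : 0 < K := by positivity
  have hΔ₀ : 0 ≤ max Δ 0 := le_max_right _ _
  -- `max Δ 0` because `Δ` may be negative; the second summand pays for the ceiling and the `+ 1` in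
  -- `N`.
  refine ⟨4 * max Δ 0 * K + 2 * εmax ^ (1 / ν), by positivity, fun n ε hn hε hεm => ?_⟩
  have hS := ZerothOrder.one_le_rpow_mul_stepsOrder hν₀ hν₁ hε hεm hn
  have hS₀ : 0 ≤ ZerothOrder.stepsOrder ν ε n := by
    unfold ZerothOrder.stepsOrder
    positivity
  -- The `+ 1` makes `N` positive even when `max Δ 0 = 0`.
  refine ⟨⌈4 * max Δ 0 * (K * ZerothOrder.stepsOrder ν ε n)⌉₊ + 1, ?_, ?_⟩
  · have h := Nat.ceil_lt_add_one (a := 4 * max Δ 0 * (K * ZerothOrder.stepsOrder ν ε n))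
      (by positivity)
    push_cast
    linarith
  intro E _ _ _ _ _ f ftil δ x₀ Ω _ P _ u hE hf hbdd hΔ hft ho hδ hind hu
  have hμ₀ : 0 < ZerothOrder.smoothing κ ν n ε := ZerothOrder.smoothing_pos hκ hε hn
  have hμ₁ : ZerothOrder.smoothing κ ν n ε < 1 := ZerothOrder.smoothing_lt_one hν₀ hκ hε hn
    ((mul_le_mul_of_nonneg_left hεm hκ.le).trans_lt hκ₂)
  have hδ₀ : 0 ≤ δ := (abs_nonneg _).trans (ho x₀)
  have hm : ∀ x, ⨅ x, f x ≤ f x := fun x => ciInf_le hbdd x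
  have hh := ZerothOrder.stepSize_pos (ν := ν) hL hμ₀ hn
  have hn1 : (1 : ℝ) ≤ n := by exact_mod_cast hn
  have herr : 410 * ZerothOrder.smoothingError ν L (ZerothOrder.smoothing κ ν n ε) n +
      40 * (δ / ZerothOrder.smoothing κ ν n ε) ^ 2 ≤ ε / 4 := by
    have h1 := ZerothOrder.sq_div_le_of_le_noiseLevel hν₁ hμ₀ hμ₁.le hn hδ₀ hδ.le
    have h2 : ZerothOrder.smoothing κ ν n ε ^ (2 * ν) ≤ κ * ε := by
      rw [ZerothOrder.smoothing_rpow_two_mul hν₀ hκ hε]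
      exact div_le_self (by positivity) (Real.one_le_rpow hn1 (by linarith))
    rw [ZerothOrder.smoothingError_smoothing hν₀ hκ hε hn]
    calc _ ≤ 410 * (L ^ 2 * (κ * ε)) + 40 * (κ * ε) := by
          gcongr
          exact h1.trans h2
      _ = (410 * L ^ 2 + 40) * κ * ε := by ring
      _ ≤ 1 / 4 * ε := by gcongr
      _ = _ := by ring
  refine ⟨fun k _ => (ZerothOrder.integrable_and_sum_integral_le hf hft ho hν₀ hν₁ hL hμ₀ hn hE hm
    hind hu).1 k, ZerothOrder.exists_integral_le_of_steps hf hft ho hν₀ hν₁ hL hμ₀ hn hE hm hind hu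
    herr (Nat.succ_pos _) ?_⟩
  have hN : 4 * max Δ 0 * (K * ZerothOrder.stepsOrder ν ε n) ≤
      ((⌈4 * max Δ 0 * (K * ZerothOrder.stepsOrder ν ε n)⌉₊ + 1 : ℕ) : ℝ) := by
    push_cast
    linarith [Nat.le_ceil (4 * max Δ 0 * (K * ZerothOrder.stepsOrder ν ε n))]
  have hinv := ZerothOrder.one_div_stepSize_mul_le hν₀ hν₁ hL hκ hε hεm hn
  rw [← hK] at hinv
  rw [← div_le_iff₀ (by positivity)]
  refine le_trans ?_ hN
  rw [div_eq_mul_one_div]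
  have : f x₀ - ⨅ x, f x ≤ max Δ 0 := hΔ.trans (le_max_left _ _)
  gcongr
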